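/- Fix a universal reference machine $U$, that is, a partial recursive function $(p,y)\mapsto U(p,y)$ taking a binary program $p$ and an input $y\in\mathbb N$ to binary strings, such that for every partial recursive $T$ of the same kind there is a constant $c$ for which $T(p,y)=x$ implies $U(q,y)=x$ for some $q$ with $|q|\le |p|+c$. Let $C(x\mid y)=\min\{|p| : U(p,y)=x\}$. A labeled graph $G$ on $n$ nodes is coded by the string $E(G)$ of $n(n-1)/2$ bits which lists, for the pairs $u<v$ of nodes in lexicographic order, whether $\{u,v\}$ is an edge. For $\delta:\mathbb N\to\mathbb R$ call $G$ $\delta(n)$-random if $C(E(G)\mid n,\delta)\ge n(n-1)/2-\delta(n)$, where $\delta$ is presented in the condition by an arbitrary natural number $d$ (for instance the value $\delta(n)$ or a program for $\delta$). A routing scheme $F$ on $G$ assigns to every node $u$ a local routing function $F(u)$, which gives for each destination $w\ne u$ reachable from $u$ a neighbour of $u$ to which messages for $w$ are forwarded. It is a shortest path routing scheme if, for all $u,w$ joined by a path, the route from $u$ to $w$ obtained in this way reaches $w$ in exactly $\mathrm{dist}_G(u,w)$ steps. Nodes are not relabeled and know their neighbours: for a fixed partial recursive interpreter $D$, a bit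 string $s$ stores $F(u)$ at $u$ if for each destination $w\neq u$ reachable from $u$, $D$ computes the label of $F(u)(w)$ from $s$, $n$, the label of $u$, the list of the labels of the neighbours of $u$, and the label of $w$. Theorem. Let $U$ be a universal reference machine, $D$ a partial recursive interpreter, and $\delta(n)=o(n)$. Then there are functions $f(n)=o(n)$ and $g(n)=o(n^2)$ such that for every $n$, every $\delta(n)$-random labeled graph $G$ on $n$ nodes (for whatever $d$), and every shortest path routing scheme $F$ on $G$: (1) for each node $u$, every bit string that stores $F(u)$ at $u$ has length at least $n/2-f(n)$; (2) if for each node $u$ the string $s_u$ stores $F(u)$ at $u$, then $\sum_u |s_u|\ge n^2/2-g(n)$. -/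

import Mathlib

namespace CompactRouting

/-! ### Kolmogorov complexity -/

/-- A (partial) description method: `M p y` is the output, if any, of the binary program `p`
when `y` is given as input. -/
abbrev Machine : Type := List Bool → ℕ →. List Bool

/-- `U` is a universal reference machine: it is partial recursive, and it simulates every
partial recursive description method at the price of a constant number of extra program bits. -/
def IsUniversal (U : Machine) : Prop :=
  Partrec₂ U ∧ ∀ T : Machine, Partrec₂ T →
    ∃ c : ℕ, ∀ (p : List Bool) (y : ℕ) (x : List Bool), x ∈ T p y →
      ∃ q : List Bool, q.length ≤ p.length + c ∧ x ∈ U q y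

/-- The conditional Kolmogorov complexity `C(x | y)` with respect to the machine `U`: the length
of a shortest program that outputs `x` on input `y`. (For universal `U` the set is nonempty.) -/
noncomputable def condComplexity (U : Machine) (x : List Bool) (y : ℕ) : ℕ :=
  sInf {k | ∃ p : List Bool, p.length = k ∧ x ∈ U p y}

theorem exists_program {U : Machine} (hU : IsUniversal U) (x : List Bool) (y : ℕ) :
    ∃ p : List Bool, x ∈ U p y := by
  obtain ⟨c, hc⟩ := hU.2 (fun p _ => Part.some p) Computable.fst.partrec.to₂
  obtain ⟨q, -, hq⟩ := hc x y x (Part.mem_some x)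
  exact ⟨q, hq⟩

/-- The standard universal machine: the program `1ⁱ 0 p` runs the `i`-th partial recursive
function on the pair of `p` and the input `y`. -/
def standardMachine : Machine := fun q y =>
  ((Denumerable.ofNat Nat.Partrec.Code (q.findIdx not)).eval
    (Encodable.encode (q.drop (q.findIdx not + 1), y))).bind
      fun r => (Encodable.decode r : Option (List Bool))

theorem standardMachine_isUniversal : IsUniversal standardMachine := by
  have hidx : Primrec fun q : List Bool => q.findIdx not :=
    Primrec.list_findIdx Primrec.id (Primrec.not.comp Primrec.snd).to₂
  refine ⟨?_, fun T hT => ?_⟩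
  · refine Partrec.bind (Nat.Partrec.Code.eval_part.comp
      ((Computable.ofNat _).comp (hidx.to_comp.comp Computable.fst))
      (Computable.encode.comp (Computable.pair ?_ Computable.snd))) ?_
    · exact (Primrec.list_drop.comp (Primrec.succ.comp (hidx.comp Primrec.fst)) Primrec.fst).to_comp
    · exact (Computable.ofOption (Computable.decode.comp Computable.snd)).to₂
  · obtain ⟨c, hc⟩ := Nat.Partrec.Code.exists_code.1 hT
    refine ⟨Encodable.encode c + 1, fun p y x hx =>
      ⟨List.replicate (Encodable.encode c) true ++ false :: p, by simp; omega, ?_⟩⟩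
    have h1 : (List.replicate (Encodable.encode c) true ++ false :: p).findIdx not
        = Encodable.encode c := by
      have h2 : ∀ k : ℕ, (List.replicate k true ++ false :: p).findIdx not = k := by
        intro k
        induction k with
        | zero => simp [List.findIdx_cons]
        | succ k ih => simp [List.replicate_succ, List.findIdx_cons, ih]
      exact h2 _
    simp only [standardMachine, h1, Denumerable.ofNat_encode, hc]
    simp [List.drop_append, hx]

/-! ### Random labeled graphs -/

open Classical in
/-- The code `E(G)` of a labeled graph: the `n(n-1)/2` possible edges `{u, v}`, `u < v`, are
listed in lexicographic order, and each contributes one bit telling whether it is present. -/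
noncomputable def edgeCode {n : ℕ} (G : SimpleGraph (Fin n)) : List Bool :=
  (List.finRange n).flatMap fun u =>
    ((List.finRange n).filter fun v => u < v).map fun v => decide (G.Adj u v)

/-- The labeled graph `G` on `n` nodes is `δ(n)`-random:
`C(E(G) | n, δ) ≥ n(n-1)/2 - δ(n)`, where `n(n-1)/2` is the logarithm of the number of labeled
graphs on `n` nodes. The number `d` is the finite object (a program, the value `δ(n)`, ...) by
which `δ` is presented in the condition. -/
def IsRandomGraph (U : Machine) (δ : ℕ → ℝ) (d : ℕ) {n : ℕ} (G : SimpleGraph (Fin n)) : Prop :=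
  (n : ℝ) * ((n : ℝ) - 1) / 2 - δ n ≤ (condComplexity U (edgeCode G) (Nat.pair n d) : ℝ)

/-! ### Routing -/

/-- `Delivers G F w k x`: following the local routing functions `F`, a message with destination
`w` that is currently at node `x` travels along edges of `G` and arrives at `w` after exactly
`k` steps. Here `F x w` is the neighbour to which node `x` forwards messages for `w`. -/
inductive Delivers {n : ℕ} (G : SimpleGraph (Fin n)) (F : Fin n → Fin n → Fin n) (w : Fin n) :
    ℕ → Fin n → Prop
  | arrive : Delivers G F w 0 w
  | step {k : ℕ} {x : Fin n} : x ≠ w → G.Adj x (F x w) → Delivers G F w k (F x w) →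
      Delivers G F w (k + 1) x

/-- The routing scheme `F` (a local routing function `F u` for every node `u`) is a shortest path
routing scheme for `G`: the route from `u` to `w` has length equal to the distance, for all nodes
`u`, `w` joined by a path. -/
def IsShortestPathScheme {n : ℕ} (G : SimpleGraph (Fin n)) (F : Fin n → Fin n → Fin n) : Prop :=
  ∀ u w : Fin n, G.Reachable u w → Delivers G F w (G.dist u w) u

open Classical in
/-- The labels of the neighbours of `u`, in increasing order. -/
noncomputable def neighbourLabels {n : ℕ} (G : SimpleGraph (Fin n)) (u : Fin n) : List ℕ :=
  ((List.finRange n).filter fun v => G.Adj u v).map fun v => (v : ℕ)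

/-- An interpreter for stored local routing functions. Its arguments are the stored bits and,
free of charge, the number of nodes, the own label of the node, the labels of the neighbours, and
the destination label. The result is the label of the neighbour to forward to. -/
abbrev Interpreter : Type := List Bool → ℕ × ℕ × List ℕ × ℕ →. ℕ

/-- With no relabeling and neighbours known, the bit string `s` stored at node `u` represents the
local routing function `f` of `u`: from `s`, `n`, `u` and the neighbours of `u`, the interpreter
computes `f w` for each destination `w ≠ u` that can be reached from `u`. -/
def Stores (D : Interpreter) {n : ℕ} (G : SimpleGraph (Fin n)) (u : Fin n) (s : List Bool)
    (f : Fin n → Fin n) : Prop :=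
  ∀ w : Fin n, w ≠ u → G.Reachable u w →
    (f w : ℕ) ∈ D s (n, (u : ℕ), neighbourLabels G u, (w : ℕ))

end CompactRouting

/-! The argument is incompressibility by counting. If a semidecidable family contains at most `2 ^
n.choose 2 * exp (-κ * n)` graphs on `n` nodes, each member can be described by its index in an
enumeration of the family. This saves a linear number of bits, so for large `n` no `δ(n)`-random
graph is a member (`eventually_notMem_of_isRandomGraph`). The decoder uses only `n` and ignores `d`,
which is why any `d` is allowed.

Fix `K ≥ 3`. Three such families are avoided. Outside `irregularGraphs` every degree is within `n /
(2 * K)` of `n / 2`. Outside `separatedGraphs` as well, nonadjacent nodes have a common neighbour,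
hence distance 2. A shortest path scheme at `u` must then name, for each of the roughly `n / 2`
non-neighbours `w`, a neighbour `v` of `u` that is adjacent to `w`. So the stored string and the
neighbourhood of `u` together reveal about `n / 2` edges `{v, w}` not incident to `u`. Graphs for
which a fixed string does this are at most a fraction of about `2 ^ (-n / 2)` of all graphs
(`card_intermediate_mul_le`). A union bound over strings shorter than `n / 2` by a linear margin
shows that `terselyRoutedGraphs` is exponentially small.

Thus each string has more than `n / 2 - 3 * n / (2 * K)` bits for large `n`. Letting `K` grow turns
the deficit into `o(n)`, and summation over the nodes gives the total. -/

namespace CompactRouting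

open Encodable

/-! ### Describing the elements of a small enumerable set -/

/-- The number with binary digits `p`, least significant digit first. -/
def bitsToNat (p : List Bool) : ℕ := p.foldr (fun b m => 2 * m + cond b 1 0) 0

theorem primrec_bitsToNat : Primrec bitsToNat := by
  refine Primrec.list_foldr (f := fun p : List Bool => p) (g := fun _ => 0)
    (h := fun _ q => 2 * q.2 + cond q.1 1 0) Primrec.id (Primrec.const 0) ?_
  exact Primrec.nat_add.comp
    (Primrec.nat_mul.comp (Primrec.const 2) (Primrec.snd.comp Primrec.snd))
    (Primrec.cond (Primrec.fst.comp Primrec.snd) (Primrec.const 1) (Primrec.const 0))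

theorem exists_bitsToNat_eq (k : ℕ) : ∀ m < 2 ^ k, ∃ p : List Bool, p.length = k ∧
    bitsToNat p = m := by
  induction k with
  | zero => intro m hm; exact ⟨[], rfl, by simp [bitsToNat]; omega⟩
  | succ k ih =>
    intro m hm
    obtain ⟨p, hp, hpm⟩ := ih (m / 2) (by rw [pow_succ] at hm; omega)
    refine ⟨decide (m % 2 = 1) :: p, by simp [hp], ?_⟩
    change 2 * bitsToNat p + cond (decide (m % 2 = 1)) 1 0 = m
    rw [hpm]
    rcases Nat.mod_two_eq_zero_or_one m with h | h <;> simp [h] <;> omega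

/-- Append `x`, if it is there and new, to the list `l`. -/
def insertNew (l : List (List Bool)) (x : Option (List Bool)) : List (List Bool) :=
  x.casesOn l fun x => if x ∈ l then l else l ++ [x]

theorem primrec_insertNew : Primrec₂ insertNew := by
  have hmem : PrimrecPred fun q : (List (List Bool) × Option (List Bool)) × List Bool =>
      q.2 ∈ q.1.1 := by
    refine ((PrimrecRel.exists_mem_list (Primrec.eq (α := List Bool))).comp
      (Primrec.fst.comp Primrec.fst) Primrec.snd).of_eq fun q => ?_
    simp
  refine Primrec.option_casesOn (o := Prod.snd) (f := Prod.fst)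
    (g := fun q x => if x ∈ q.1 then q.1 else q.1 ++ [x]) Primrec.snd Primrec.fst ?_
  exact Primrec.ite hmem (Primrec.fst.comp Primrec.fst)
    (Primrec.list_concat.comp (Primrec.fst.comp Primrec.fst) Primrec.snd)

theorem prefix_insertNew (l : List (List Bool)) (x : Option (List Bool)) :
    l <+: insertNew l x := by
  cases x with
  | none => exact List.prefix_refl l
  | some x => simp only [insertNew]; split_ifs <;> simp

theorem nodup_insertNew {l : List (List Bool)} (hl : l.Nodup) (x : Option (List Bool)) :
    (insertNew l x).Nodup := by
  cases x with
  | none => exact hl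
  | some x =>
    simp only [insertNew]
    split_ifs with h
    · exact hl
    · rw [List.nodup_append]
      exact ⟨hl, List.nodup_singleton x, by rintro a ha b hb rfl; simp_all⟩

theorem mem_insertNew {l : List (List Bool)} {x : Option (List Bool)} {y : List Bool} :
    y ∈ insertNew l x ↔ y ∈ l ∨ x = some y := by
  cases x with
  | none => simp [insertNew]
  | some x =>
    simp only [insertNew]
    split_ifs with h
    · constructor
      · exact Or.inl
      · rintro (h' | h')
        · exact h'
        · cases h'; exact h
    · simp [eq_comm]

section Enumeration

variable {σ : Type*} [Primcodable σ] (h : ℕ × σ → Option (List Bool))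

/-- The distinct values of `h (n, ·)` found by inspecting the first `j` arguments. -/
def foundValues (n j : ℕ) : List (List Bool) :=
  Nat.rec [] (fun i l => insertNew l ((decode (α := σ) i).bind fun a => h (n, a))) j

theorem foundValues_succ (n j : ℕ) : foundValues h n (j + 1) =
    insertNew (foundValues h n j) ((decode (α := σ) j).bind fun a => h (n, a)) := rfl

variable {h}

theorem primrec_foundValues (hh : Primrec h) : Primrec₂ (foundValues h) := by
  refine Primrec.nat_rec (f := fun _ : ℕ => ([] : List (List Bool)))
    (g := fun n q => insertNew q.2 ((decode (α := σ) q.1).bind fun a => h (n, a)))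
    (Primrec.const []) ?_
  refine primrec_insertNew.comp (Primrec.snd.comp Primrec.snd) ?_
  refine Primrec.option_bind (Primrec.decode.comp (Primrec.fst.comp Primrec.snd)) ?_
  exact hh.comp ((Primrec.fst.comp Primrec.fst).pair Primrec.snd)

/-- Later stages only append, so the index of a value never changes; this makes an index a valid
description. -/
theorem foundValues_prefix (n : ℕ) {i j : ℕ} (hij : i ≤ j) :
    foundValues h n i <+: foundValues h n j := by
  induction hij with
  | refl => exact List.prefix_refl _
  | step _ ih => exact ih.trans (prefix_insertNew _ _)

/-- Without repetitions the list is no longer than the set is large, so `k` bits suffice for an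
index. -/
theorem nodup_foundValues (n j : ℕ) : (foundValues h n j).Nodup := by
  induction j with
  | zero => exact List.nodup_nil
  | succ j ih => exact nodup_insertNew ih _

theorem exists_of_mem_foundValues {n j : ℕ} {x : List Bool} (hx : x ∈ foundValues h n j) :
    ∃ a, h (n, a) = some x := by
  induction j with
  | zero => simp [foundValues] at hx
  | succ j ih =>
    rw [foundValues_succ, mem_insertNew] at hx
    rcases hx with hx | hx
    · exact ih hx
    · obtain ⟨a, -, ha⟩ := Option.bind_eq_some_iff.1 hx
      exact ⟨a, ha⟩

theorem mem_foundValues {n : ℕ} {x : List Bool} {a : σ} (ha : h (n, a) = some x) :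
    x ∈ foundValues h n (encode a + 1) := by
  rw [foundValues_succ, mem_insertNew]
  exact Or.inr (by simp [ha])

variable (h) in
/-- The machine that reads its program as an index into the enumeration of the values of
`h (n, ·)`, where `n` is the first component of the input. -/
def enumerationMachine : Machine := fun p y =>
  Nat.rfindOpt fun j => (foundValues h y.unpair.1 j)[bitsToNat p]?

theorem partrec_enumerationMachine (hh : Primrec h) : Partrec₂ (enumerationMachine h) := by
  refine Partrec.rfindOpt (f := fun (q : List Bool × ℕ) j =>
    (foundValues h q.2.unpair.1 j)[bitsToNat q.1]?) (Primrec.to_comp ?_)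
  refine Primrec.list_getElem?.comp ((primrec_foundValues hh).comp ?_ Primrec.snd)
    (primrec_bitsToNat.comp (Primrec.fst.comp Primrec.fst))
  exact Primrec.fst.comp (Primrec.unpair.comp (Primrec.snd.comp Primrec.fst))

/-- An element of an enumerable set with at most `2 ^ k` elements has complexity at most `k`, up
to a constant. -/
theorem condComplexity_le_of_enumeration {U : Machine} (hU : IsUniversal U) (hh : Primrec h) :
    ∃ c : ℕ, ∀ (n d k : ℕ) (S : Finset (List Bool)), (∀ a x, h (n, a) = some x → x ∈ S) →
      S.card ≤ 2 ^ k → ∀ a x, h (n, a) = some x →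
        condComplexity U x (Nat.pair n d) ≤ k + c := by
  obtain ⟨c, hc⟩ := hU.2 _ (partrec_enumerationMachine hh)
  refine ⟨c, fun n d k S hS hk a x hx => ?_⟩
  obtain ⟨i, hi, hix⟩ := List.getElem_of_mem (mem_foundValues hx)
  have hcard : (foundValues h n (encode a + 1)).length ≤ 2 ^ k := by
    rw [← List.toFinset_card_of_nodup (nodup_foundValues n _)]
    refine (Finset.card_le_card fun y hy => ?_).trans hk
    obtain ⟨b, hb⟩ := exists_of_mem_foundValues (List.mem_toFinset.1 hy)
    exact hS b y hb
  obtain ⟨p, hp, hpi⟩ := exists_bitsToNat_eq k i (by omega)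
  obtain ⟨q, hq, hqx⟩ := hc p (Nat.pair n d) x (by
    -- The search stops at the first stage with enough entries, possibly before stage `encode a +
    -- 1`; by the prefix property both stages have the same entry at this index.
    refine (Nat.rfindOpt_mono ?_).2 ⟨encode a + 1, ?_⟩
    · intro y m m' hm hy
      obtain ⟨t, ht⟩ := foundValues_prefix (h := h) (Nat.pair n d).unpair.1 hm
      have hy' := Option.mem_def.1 hy
      rw [Option.mem_def, ← ht, List.getElem?_append_left (List.getElem?_eq_some_iff.1 hy').1]
      exact hy'
    · simp [hpi, hi, hix])
  have hle : condComplexity U x (Nat.pair n d) ≤ q.length := Nat.sInf_le ⟨q, rfl, hqx⟩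
  exact hle.trans (hp ▸ hq)

end Enumeration

end CompactRouting

namespace CompactRouting

/-! ### Random graphs avoid small semidecidable families -/

/-- `u` and `v` are joined in the graph with the list of edges `a`. -/
def HasEdge (a : List (ℕ × ℕ)) (u v : ℕ) : Prop := u ≠ v ∧ ((u, v) ∈ a ∨ (v, u) ∈ a)

/-- The graph on `n` nodes with the list of edges `a`. -/
def graphOfEdges (n : ℕ) (a : List (ℕ × ℕ)) : SimpleGraph (Fin n) where
  Adj u v := HasEdge a u v
  symm := ⟨fun _ _ h => ⟨h.1.symm, h.2.symm⟩⟩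
  loopless := ⟨fun _ h => h.1 rfl⟩

theorem exists_graphOfEdges_eq {n : ℕ} (G : SimpleGraph (Fin n)) :
    ∃ a, graphOfEdges n a = G := by
  classical
  refine ⟨((Finset.univ.filter fun q : Fin n × Fin n => G.Adj q.1 q.2).toList.map
    fun q => ((q.1 : ℕ), (q.2 : ℕ))), ?_⟩
  ext u v
  have key : ∀ u v : Fin n, ((u : ℕ), (v : ℕ)) ∈ ((Finset.univ.filter
      fun q : Fin n × Fin n => G.Adj q.1 q.2).toList.map fun q => ((q.1 : ℕ), (q.2 : ℕ))) ↔
      G.Adj u v := by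
    intro u v
    simp [Fin.val_inj]
  change HasEdge _ _ _ ↔ _
  rw [HasEdge, key, key, G.adj_comm v u, or_self]
  exact ⟨fun h => h.2, fun h => ⟨fun h' => h.ne (Fin.ext h'), h⟩⟩

theorem primrecPred_hasEdge {α : Type*} [Primcodable α] {a : α → List (ℕ × ℕ)} {u v : α → ℕ}
    (ha : Primrec a) (hu : Primrec u) (hv : Primrec v) :
    PrimrecPred fun x => HasEdge (a x) (u x) (v x) := by
  have hmem : PrimrecRel fun (a : List (ℕ × ℕ)) (q : ℕ × ℕ) => q ∈ a :=
    (PrimrecRel.exists_mem_list (Primrec.eq (α := ℕ × ℕ))).of_eq fun a q => by simp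
  exact (Primrec.eq.comp hu hv).not.and
    ((hmem.comp ha (hu.pair hv)).or (hmem.comp ha (hv.pair hu)))

open Classical in
/-- The code of the graph on `n` nodes with the list of edges `a`, in terms of numbers. -/
noncomputable def codeOfEdges (n : ℕ) (a : List (ℕ × ℕ)) : List Bool :=
  (List.range n).flatMap fun u =>
    ((List.range n).filter fun v => u < v).map fun v => decide (HasEdge a u v)

theorem map_val_finRange (n : ℕ) : (List.finRange n).map Fin.val = List.range n := by
  simp

theorem edgeCode_graphOfEdges (n : ℕ) (a : List (ℕ × ℕ)) :
    edgeCode (graphOfEdges n a) = codeOfEdges n a := by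
  classical
  rw [codeOfEdges, ← map_val_finRange, List.flatMap_map, edgeCode]
  congr 1
  funext u
  rw [List.filter_map, List.map_map]
  rfl

theorem primrec_codeOfEdges : Primrec₂ codeOfEdges := by
  classical
  refine Primrec.list_flatMap (f := fun q : ℕ × List (ℕ × ℕ) => List.range q.1)
    (g := fun q u => ((List.range q.1).filter fun v => u < v).map
      fun v => decide (HasEdge q.2 u v))
    (Primrec.list_range.comp Primrec.fst) ?_
  refine Primrec.list_map (f := fun q : (ℕ × List (ℕ × ℕ)) × ℕ =>
    (List.range q.1.1).filter fun v => q.2 < v) (g := fun q v => decide (HasEdge q.1.2 q.2 v))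
    ?_ ?_
  · exact (PrimrecRel.listFilter (R := fun v u : ℕ => u < v) Primrec.nat_lt.swap).comp
      (Primrec.list_range.comp (Primrec.fst.comp Primrec.fst)) Primrec.snd
  · exact (primrecPred_hasEdge (Primrec.snd.comp (Primrec.fst.comp Primrec.fst))
      (Primrec.snd.comp Primrec.fst) Primrec.snd).decide

/-- A family of labeled graphs is semidecidable: membership of the graph given by a list of edges
amounts to the existence of a witness for a primitive recursive predicate. -/
def IsSemidecidable (𝓢 : ∀ n, Set (SimpleGraph (Fin n))) : Prop :=
  ∃ Q : ℕ × List (ℕ × ℕ) × ℕ → Prop, PrimrecPred Q ∧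
    ∀ n a, graphOfEdges n a ∈ 𝓢 n ↔ ∃ w, Q (n, a, w)

theorem isSemidecidable_of_witness {𝓢 : ∀ n, Set (SimpleGraph (Fin n))} {σ : Type*}
    [Primcodable σ] (Q : ℕ × List (ℕ × ℕ) × σ → Prop) (hQ : PrimrecPred Q)
    (h : ∀ n a, graphOfEdges n a ∈ 𝓢 n ↔ ∃ w, Q (n, a, w)) : IsSemidecidable 𝓢 := by
  classical
  refine ⟨fun q => (Option.casesOn (Encodable.decode (α := σ) q.2.2) false
    fun w => decide (Q (q.1, q.2.1, w)) : Bool) = true, ?_, fun n a => ?_⟩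
  · refine Primrec.eq.comp (Primrec.option_casesOn
      (Primrec.decode.comp (Primrec.snd.comp Primrec.snd)) (Primrec.const false) ?_)
      (Primrec.const true)
    exact hQ.decide.comp ((Primrec.fst.comp Primrec.fst).pair
      ((Primrec.fst.comp (Primrec.snd.comp Primrec.fst)).pair Primrec.snd))
  · rw [h]
    constructor
    · rintro ⟨w, hw⟩
      exact ⟨Encodable.encode w, by simp [hw]⟩
    · rintro ⟨i, hi⟩
      cases hd : Encodable.decode (α := σ) i with
      | none => simp [hd] at hi
      | some w => exact ⟨w, by simpa [hd] using hi⟩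

/-- Searching through all pairs of an edge list and a witness enumerates the codes of the family.
Different edge lists may give the same graph, which is harmless because only distinct codes are
counted. -/
theorem condComplexity_edgeCode_le {U : Machine} (hU : IsUniversal U)
    {𝓢 : ∀ n, Set (SimpleGraph (Fin n))} (h𝓢 : IsSemidecidable 𝓢) :
    ∃ c : ℕ, ∀ n d k, (𝓢 n).ncard ≤ 2 ^ k → ∀ G ∈ 𝓢 n,
      condComplexity U (edgeCode G) (Nat.pair n d) ≤ k + c := by
  classical
  obtain ⟨Q, hQ, h⟩ := h𝓢
  have hprim : Primrec fun q : ℕ × List (ℕ × ℕ) × ℕ =>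
      if Q q then some (codeOfEdges q.1 q.2.1) else none :=
    Primrec.ite hQ (Primrec.option_some.comp
      (primrec_codeOfEdges.comp Primrec.fst (Primrec.fst.comp Primrec.snd))) (Primrec.const none)
  obtain ⟨c, hc⟩ := condComplexity_le_of_enumeration hU hprim
  refine ⟨c, fun n d k hk G hG => ?_⟩
  obtain ⟨a, rfl⟩ := exists_graphOfEdges_eq G
  obtain ⟨w, hw⟩ := (h n a).1 hG
  rw [edgeCode_graphOfEdges]
  refine hc n d k ((Set.toFinite (𝓢 n)).toFinset.image edgeCode) ?_ ?_ (a, w) _ (by simp [hw])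
  · rintro ⟨b, v⟩ x hx
    simp only [Option.ite_none_right_eq_some, Option.some.injEq] at hx
    rw [Finset.mem_image]
    exact ⟨graphOfEdges n b, by simpa using (h n b).2 ⟨v, hx.1⟩,
      by rw [edgeCode_graphOfEdges, hx.2]⟩
  · refine Finset.card_image_le.trans ?_
    rwa [← Set.ncard_eq_toFinset_card]

open Filter in
/-- Eventually, no `δ(n)`-random graph belongs to a semidecidable family that is exponentially
small among all graphs. -/
theorem eventually_notMem_of_isRandomGraph {U : Machine} (hU : IsUniversal U) {δ : ℕ → ℝ}
    (hδ : δ =o[atTop] fun n : ℕ => (n : ℝ)) {𝓢 : ∀ n, Set (SimpleGraph (Fin n))}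
    (h𝓢 : IsSemidecidable 𝓢) {κ : ℝ} (hκ : 0 < κ)
    (hcard : ∀ᶠ n : ℕ in atTop,
      ((𝓢 n).ncard : ℝ) ≤ 2 ^ n.choose 2 * Real.exp (-κ * n)) :
    ∀ᶠ n : ℕ in atTop, ∀ (d : ℕ) (G : SimpleGraph (Fin n)), IsRandomGraph U δ d G →
      G ∉ 𝓢 n := by
  obtain ⟨c, hc⟩ := condComplexity_edgeCode_le hU h𝓢
  have h1 := hδ.bound (show (0 : ℝ) < κ / 2 by positivity)
  have h2 : ∀ᶠ n : ℕ in atTop, (c : ℝ) + 1 < κ / 2 * n :=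
    (tendsto_natCast_atTop_atTop.const_mul_atTop (by positivity)).eventually_gt_atTop _
  filter_upwards [hcard, h1, h2] with n hn h1 h2 d G hG hmem
  have hle := hc n d (Nat.clog 2 (𝓢 n).ncard) (Nat.le_pow_clog one_lt_two _) G hmem
  have hpos : 0 < (𝓢 n).ncard := (Set.ncard_pos).2 ⟨G, hmem⟩
  -- Rounding the index length up to whole bits costs at most one bit, the `1` in `c + 1`.
  have hclog : (2 : ℝ) ^ (Nat.clog 2 (𝓢 n).ncard) ≤ 2 * (𝓢 n).ncard := by
    rcases Nat.lt_or_ge 1 (𝓢 n).ncard with h | h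
    · have := Nat.pow_pred_clog_lt_self one_lt_two h
      have h3 : 0 < Nat.clog 2 (𝓢 n).ncard := Nat.clog_pos one_lt_two h
      have h4 : 2 ^ Nat.clog 2 (𝓢 n).ncard ≤ 2 * (𝓢 n).ncard := by
        obtain ⟨j, hj⟩ := Nat.exists_eq_succ_of_ne_zero h3.ne'
        rw [hj] at this ⊢
        simp only [Nat.pred_succ] at this
        rw [pow_succ]; omega
      exact_mod_cast h4
    · have : (𝓢 n).ncard = 1 := by omega
      simp [this]
  have hlog : (Nat.clog 2 (𝓢 n).ncard : ℝ) * Real.log 2 ≤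
      Real.log 2 + n.choose 2 * Real.log 2 - κ * n := by
    have := Real.log_le_log (by positivity)
      (hclog.trans (mul_le_mul_of_nonneg_left hn zero_le_two))
    rw [Real.log_pow, Real.log_mul two_ne_zero (by positivity),
      Real.log_mul (by positivity) (by positivity), Real.log_pow, Real.log_exp] at this
    linarith
  have hG' : (n : ℝ) * ((n : ℝ) - 1) / 2 - δ n ≤ Nat.clog 2 (𝓢 n).ncard + c :=
    hG.trans (by exact_mod_cast hle)
  rw [← Nat.cast_choose_two ℝ n] at hG'
  have hδn : δ n ≤ κ / 2 * n := by
    have := (le_abs_self _).trans h1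
    simpa using this
  have hl0 : 0 < Real.log 2 := Real.log_pos one_lt_two
  have hl1 : Real.log 2 < 1 := Real.log_two_lt_d9.trans (by norm_num)
  -- The constant overhead and the randomness deficiency each use at most half of `κ * n`. Since `κ`
  -- is measured in base `e` and `log 2 < 1`, the family saves more than `κ * n` bits.
  have h5 : (c + 1 + δ n) * Real.log 2 < κ * n * Real.log 2 :=
    mul_lt_mul_of_pos_right (by linarith) hl0
  have h6 : κ * n * Real.log 2 ≤ κ * n * 1 := mul_le_mul_of_nonneg_left hl1.le (by positivity)
  have h7 := mul_le_mul_of_nonneg_right hG' hl0.le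
  rw [sub_mul, add_mul] at h7
  rw [add_mul, add_mul] at h5
  linarith

end CompactRouting

namespace CompactRouting

/-! ### Counting graphs -/

open Finset

variable {n : ℕ}

open Classical in
/-- The set of neighbours of `u`. -/
noncomputable def nbrs (G : SimpleGraph (Fin n)) (u : Fin n) : Finset (Fin n) :=
  univ.filter fun v => G.Adj u v

@[simp]
theorem mem_nbrs {G : SimpleGraph (Fin n)} {u v : Fin n} : v ∈ nbrs G u ↔ G.Adj u v := by
  simp [nbrs]

/-- The graph obtained from `G` by changing the adjacency of the pairs in `X`. -/
def flipEdges (G : SimpleGraph (Fin n)) (X : Finset (Sym2 (Fin n))) : SimpleGraph (Fin n) :=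
  SimpleGraph.fromEdgeSet {e | ¬(e ∈ G.edgeSet ↔ e ∈ X)}

theorem mem_edgeSet_flipEdges {G : SimpleGraph (Fin n)} {X : Finset (Sym2 (Fin n))}
    {e : Sym2 (Fin n)} (he : ¬e.IsDiag) :
    e ∈ (flipEdges G X).edgeSet ↔ ¬(e ∈ G.edgeSet ↔ e ∈ X) := by
  simp [flipEdges, SimpleGraph.edgeSet_fromEdgeSet, he]

/-- For fixed `X`, flipping is invertible: adjacency of each non-diagonal pair can be read back. -/
theorem eq_of_flipEdges_eq {G G' : SimpleGraph (Fin n)} {X : Finset (Sym2 (Fin n))}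
    (h : flipEdges G X = flipEdges G' X) : G = G' := by
  rw [← SimpleGraph.edgeSet_inj]
  ext e
  by_cases he : e.IsDiag
  · exact iff_of_false (fun h => G.not_isDiag_of_mem_edgeSet h he)
      (fun h => G'.not_isDiag_of_mem_edgeSet h he)
  · have h1 := mem_edgeSet_flipEdges (G := G) (X := X) he
    rw [h, mem_edgeSet_flipEdges he] at h1
    tauto

open Classical in
theorem card_simpleGraph_le (n : ℕ) :
    (univ : Finset (SimpleGraph (Fin n))).card ≤ 2 ^ n.choose 2 := by
  have htop := SimpleGraph.card_edgeFinset_top_eq_card_choose_two (V := Fin n)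
  rw [Fintype.card_fin] at htop
  rw [← htop, ← card_powerset]
  refine card_le_card_of_injOn (fun G => G.edgeFinset) (fun G _ => ?_) fun G _ G' _ h => ?_
  · rw [mem_coe, mem_powerset]
    exact SimpleGraph.edgeFinset_mono le_top
  · exact SimpleGraph.edgeFinset_inj.1 h

/-- If the neighbours of `u` determine at least `b` pairs of other nodes on whose adjacency the
graphs in `𝓑` agree, then `𝓑` contains at most the fraction `2 ^ (-b)` of all graphs. -/
theorem card_mul_two_pow_le (𝓑 : Finset (SimpleGraph (Fin n))) (u : Fin n)
    (P : Finset (Fin n) → Finset (Sym2 (Fin n))) (b : ℕ)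
    (hu : ∀ G ∈ 𝓑, ∀ e ∈ P (nbrs G u), u ∉ e)
    (hdiag : ∀ G ∈ 𝓑, ∀ e ∈ P (nbrs G u), ¬e.IsDiag)
    (hagree : ∀ G ∈ 𝓑, ∀ G' ∈ 𝓑, nbrs G u = nbrs G' u →
      ∀ e ∈ P (nbrs G u), e ∈ G.edgeSet ↔ e ∈ G'.edgeSet)
    (hb : ∀ G ∈ 𝓑, b ≤ (P (nbrs G u)).card) :
    𝓑.card * 2 ^ b ≤ 2 ^ n.choose 2 := by
  classical
  calc 𝓑.card * 2 ^ b = ∑ G ∈ 𝓑, 2 ^ b := by simp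
    _ ≤ ∑ G ∈ 𝓑, (P (nbrs G u)).powerset.card := by
        refine sum_le_sum fun G hG => ?_
        rw [card_powerset]
        exact Nat.pow_le_pow_right two_pos (hb G hG)
    _ = (𝓑.sigma fun G => (P (nbrs G u)).powerset).card := (card_sigma _ _).symm
    _ ≤ (univ : Finset (SimpleGraph (Fin n))).card := ?_
    _ ≤ _ := card_simpleGraph_le n
  -- Injectivity: flipped pairs avoid `u`, so the flipped graph still shows the neighbourhood of `u`
  -- and hence `P`. On `P` the original adjacencies are forced by `hagree`, so comparison recovers
  -- `X`, and then `G`.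
  refine card_le_card_of_injOn (fun q => flipEdges q.1 q.2) (fun _ _ => mem_coe.2 (mem_univ _)) ?_
  have hnbrs : ∀ G ∈ 𝓑, ∀ X ⊆ P (nbrs G u), nbrs (flipEdges G X) u = nbrs G u := by
    intro G hG X hX
    ext v
    rw [mem_nbrs, mem_nbrs]
    by_cases huv : u = v
    · subst huv; simp
    · rw [← SimpleGraph.mem_edgeSet, mem_edgeSet_flipEdges (by simpa using huv),
        SimpleGraph.mem_edgeSet]
      have : s(u, v) ∉ X := fun h => hu G hG _ (hX h) (by simp)
      tauto
  rintro ⟨G, X⟩ h1 ⟨G', X'⟩ h2 h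
  simp only [coe_sigma, Set.mem_sigma_iff, mem_coe, mem_powerset] at h1 h2
  obtain ⟨hG, hX⟩ := h1
  obtain ⟨hG', hX'⟩ := h2
  replace h : flipEdges G X = flipEdges G' X' := h
  have hN : nbrs G u = nbrs G' u := by
    rw [← hnbrs G hG X hX, ← hnbrs G' hG' X' hX', h]
  have hXX : X = X' := by
    ext e
    by_cases he : e ∈ P (nbrs G u)
    · have h3 := mem_edgeSet_flipEdges (G := G) (X := X) (hdiag G hG e he)
      rw [h, mem_edgeSet_flipEdges (hdiag G hG e he)] at h3
      have h4 := hagree G hG G' hG' hN e he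
      tauto
    · exact iff_of_false (fun h => he (hX h)) (fun h => he (hN ▸ hX' h))
  subst hXX
  rw [eq_of_flipEdges_eq h]

/-- The graphs whose neighbourhoods of `u` belong to `𝓐` are at most the fraction
`|𝓐| / 2 ^ (n - 1)` of all graphs. -/
theorem card_mul_two_pow_le_card_mul (𝓑 : Finset (SimpleGraph (Fin n))) (u : Fin n)
    (𝓐 : Finset (Finset (Fin n))) (h𝓐 : ∀ G ∈ 𝓑, nbrs G u ∈ 𝓐) :
    𝓑.card * 2 ^ (n - 1) ≤ 𝓐.card * 2 ^ n.choose 2 := by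
  classical
  have hcard : ((univ : Finset (Fin n)).erase u).powerset.card = 2 ^ (n - 1) := by
    rw [card_powerset, card_erase_of_mem (mem_univ u), card_univ, Fintype.card_fin]
  rw [← hcard, ← card_product]
  refine le_trans ?_ (Nat.mul_le_mul_left _ (card_simpleGraph_le n))
  rw [← card_product]
  -- Resampling the edges at `u`: the neighbourhood is recorded separately, so the flips `X` at `u`
  -- can be read off the flipped graph, and then `G` as well.
  refine card_le_card_of_injOn
    (fun q => (nbrs q.1 u, flipEdges q.1 (q.2.image fun x => s(u, x)))) ?_ ?_
  · rintro ⟨G, X⟩ h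
    simp only [coe_product, Set.mem_prod, mem_coe] at h ⊢
    exact ⟨h𝓐 G h.1, mem_univ _⟩
  · rintro ⟨G, X⟩ h1 ⟨G', X'⟩ h2 h
    simp only [coe_product, Set.mem_prod, mem_coe, mem_powerset] at h1 h2
    simp only [Prod.mk.injEq] at h
    obtain ⟨hN, h⟩ := h
    have hXX : X = X' := by
      ext v
      by_cases huv : u = v
      · subst huv
        exact iff_of_false (fun h => notMem_erase _ _ (h1.2 h)) (fun h => notMem_erase _ _ (h2.2 h))
      · have hd : ¬s(u, v).IsDiag := by simpa using huv
        have hmem : ∀ Y : Finset (Fin n), s(u, v) ∈ Y.image (fun x => s(u, x)) ↔ v ∈ Y := by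
          intro Y
          simp [huv]
        have h3 := mem_edgeSet_flipEdges (G := G) (X := X.image fun x => s(u, x)) hd
        rw [h, mem_edgeSet_flipEdges hd, hmem, hmem, SimpleGraph.mem_edgeSet,
          SimpleGraph.mem_edgeSet, ← mem_nbrs, ← mem_nbrs, hN] at h3
        tauto
    subst hXX
    rw [eq_of_flipEdges_eq h]

/-- The graphs in which the nonadjacent nodes `u` and `w` have no common neighbour, although `u`
has at least `b` neighbours. -/
theorem card_noCommonNeighbour_mul_le (𝓑 : Finset (SimpleGraph (Fin n))) (u w : Fin n) (b : ℕ)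
    (huw : u ≠ w) (hadj : ∀ G ∈ 𝓑, ¬G.Adj u w) (hb : ∀ G ∈ 𝓑, b ≤ (nbrs G u).card)
    (hno : ∀ G ∈ 𝓑, ∀ v, ¬(G.Adj u v ∧ G.Adj v w)) :
    𝓑.card * 2 ^ b ≤ 2 ^ n.choose 2 := by
  classical
  refine card_mul_two_pow_le 𝓑 u (fun A => A.image fun v => s(v, w)) b ?_ ?_ ?_ ?_
  · intro G hG e he
    obtain ⟨v, hv, rfl⟩ := mem_image.1 he
    rw [mem_nbrs] at hv
    simp [huw, hv.ne]
  · intro G hG e he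
    obtain ⟨v, hv, rfl⟩ := mem_image.1 he
    rw [mem_nbrs] at hv
    simp only [Sym2.mk_isDiag_iff]
    rintro rfl
    exact hadj G hG hv
  · intro G hG G' hG' hN e he
    obtain ⟨v, hv, rfl⟩ := mem_image.1 he
    have hv' := hv
    rw [hN, mem_nbrs] at hv'
    rw [mem_nbrs] at hv
    exact iff_of_false (fun h => hno G hG v ⟨hv, h⟩) (fun h => hno G' hG' v ⟨hv', h⟩)
  · intro G hG
    rw [card_image_of_injective]
    · exact hb G hG
    · intro v v' h
      rcases Sym2.eq_iff.1 h with h | h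
      · exact h.1
      · exact h.1.trans h.2

/-- The graphs in which the neighbours of `u` determine for each other node `w` a common neighbour
`φ w` of `u` and `w`, and in which `u` has at least `b` non-neighbours. -/
theorem card_intermediate_mul_le (𝓑 : Finset (SimpleGraph (Fin n))) (u : Fin n) (b : ℕ)
    (φ : Finset (Fin n) → Fin n → Fin n)
    (hφ : ∀ G ∈ 𝓑, ∀ w, w ≠ u → ¬G.Adj u w →
      G.Adj u (φ (nbrs G u) w) ∧ G.Adj (φ (nbrs G u) w) w)
    (hb : ∀ G ∈ 𝓑, b + (nbrs G u).card + 1 ≤ n) :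
    𝓑.card * 2 ^ b ≤ 2 ^ n.choose 2 := by
  classical
  refine card_mul_two_pow_le 𝓑 u
    (fun A => ((univ.erase u) \ A).image fun w => s(φ A w, w)) b ?_ ?_ ?_ ?_
  · intro G hG e he
    obtain ⟨w, hw, rfl⟩ := mem_image.1 he
    simp only [mem_sdiff, mem_erase, mem_univ, and_true, mem_nbrs] at hw
    simp [hw.1.symm, (hφ G hG w hw.1 hw.2).1.ne]
  · intro G hG e he
    obtain ⟨w, hw, rfl⟩ := mem_image.1 he
    simp only [mem_sdiff, mem_erase, mem_univ, and_true, mem_nbrs] at hw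
    simpa using (hφ G hG w hw.1 hw.2).2.ne
  · intro G hG G' hG' hN e he
    obtain ⟨w, hw, rfl⟩ := mem_image.1 he
    have hw' := hw
    rw [hN] at hw'
    simp only [mem_sdiff, mem_erase, mem_univ, and_true, mem_nbrs] at hw hw'
    refine iff_of_true (hφ G hG w hw.1 hw.2).2 ?_
    rw [hN]
    exact (hφ G' hG' w hw'.1 hw'.2).2
  · intro G hG
    rw [card_image_of_injOn]
    · have h1 := le_card_sdiff (nbrs G u) (univ.erase u)
      rw [card_erase_of_mem (mem_univ u), card_univ, Fintype.card_fin] at h1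
      have := hb G hG
      omega
    · intro w hw w' hw' h
      simp only [mem_coe, mem_sdiff, mem_erase, mem_univ, and_true, mem_nbrs] at hw hw'
      simp only [Sym2.eq_iff] at h
      rcases h with h | h
      · exact h.2
      -- In the swapped case `w'` would be the intermediate node of `w`, hence a neighbour of `u`.
      · exact absurd (h.1 ▸ (hφ G hG w hw.1 hw.2).1) hw'.2

/-- Chernoff bound in counting form: give `A` the weight `exp (η * (|A| - |s \ A|))`. The weights of
all subsets of `s` sum to `(2 * cosh η) ^ |s|`, with `cosh η ≤ exp (η ^ 2 / 2)`, and each member of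
`𝓐` weighs at least `exp t`. -/
theorem card_le_of_weight {ι : Type*} (s : Finset ι) (𝓐 : Finset (Finset ι)) (η t : ℝ)
    (h𝓐 : ∀ A ∈ 𝓐, A ⊆ s ∧ t ≤ η * (2 * (A.card : ℝ) - s.card)) :
    (𝓐.card : ℝ) ≤ 2 ^ s.card * Real.exp (s.card * (η ^ 2 / 2) - t) := by
  classical
  have h1 : (𝓐.card : ℝ) * Real.exp t ≤ ∑ A ∈ s.powerset,
      Real.exp η ^ A.card * Real.exp (-η) ^ (s.card - A.card) := by
    calc (𝓐.card : ℝ) * Real.exp t = ∑ A ∈ 𝓐, Real.exp t := by simp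
      _ ≤ ∑ A ∈ 𝓐, Real.exp η ^ A.card * Real.exp (-η) ^ (s.card - A.card) := by
          refine sum_le_sum fun A hA => ?_
          rw [← Real.exp_nat_mul, ← Real.exp_nat_mul, ← Real.exp_add,
            Nat.cast_sub (card_le_card (h𝓐 A hA).1)]
          refine Real.exp_le_exp.2 ((h𝓐 A hA).2.trans (le_of_eq (by ring)))
      _ ≤ _ := sum_le_sum_of_subset_of_nonneg
          (fun A hA => mem_powerset.2 (h𝓐 A hA).1) fun _ _ _ => by positivity
  rw [sum_pow_mul_eq_add_pow] at h1
  have h2 : (Real.exp η + Real.exp (-η)) ^ s.card ≤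
      2 ^ s.card * Real.exp (s.card * (η ^ 2 / 2)) := by
    rw [Real.exp_nat_mul, ← mul_pow]
    refine pow_le_pow_left₀ (by positivity) ?_ _
    have := Real.cosh_le_exp_half_sq η
    rw [Real.cosh_eq] at this
    linarith
  rw [Real.exp_sub, ← mul_div_assoc, le_div_iff₀ (Real.exp_pos t)]
  exact h1.trans h2

theorem ncard_le_card_mul {ι : Type*} [Fintype ι] (𝓢 : Set (SimpleGraph (Fin n)))
    (B : ι → Finset (SimpleGraph (Fin n))) (hB : ∀ G ∈ 𝓢, ∃ i, G ∈ B i) (M : ℝ)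
    (hM : ∀ i, ((B i).card : ℝ) ≤ M) : (𝓢.ncard : ℝ) ≤ Fintype.card ι * M := by
  classical
  have h1 : 𝓢.ncard ≤ (univ.biUnion B).card := by
    rw [← Set.ncard_coe_finset]
    refine Set.ncard_le_ncard (fun G hG => ?_) (Set.toFinite _)
    simpa using hB G hG
  calc (𝓢.ncard : ℝ) ≤ (∑ i, (B i).card : ℕ) := by exact_mod_cast h1.trans card_biUnion_le
    _ = ∑ i, ((B i).card : ℝ) := by push_cast; rfl
    _ ≤ ∑ _i : ι, M := sum_le_sum fun i _ => hM i
    _ = Fintype.card ι * M := by simp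

open Filter in
-- Half of the exponential rate absorbs the polynomial factors from union bounds over nodes and
-- string lengths.
theorem eventually_poly_mul_exp_le (C : ℝ) (k : ℕ) {κ : ℝ} (hκ : 0 < κ) :
    ∀ᶠ n : ℕ in atTop, C * (n : ℝ) ^ k * Real.exp (-(2 * κ) * n) ≤ Real.exp (-κ * n) := by
  have h1 := (Real.tendsto_pow_mul_exp_neg_atTop_nhds_zero k).comp
    (tendsto_natCast_atTop_atTop.const_mul_atTop hκ)
  have h2 := h1.const_mul (C / κ ^ k)
  rw [mul_zero] at h2
  filter_upwards [h2.eventually_le_const zero_lt_one] with n hn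
  simp only [Function.comp] at hn
  have h3 : C * (n : ℝ) ^ k * Real.exp (-(κ * n)) ≤ 1 := by
    refine le_trans (le_of_eq ?_) hn
    rw [mul_pow]
    field_simp
  have h4 : Real.exp (-(2 * κ) * n) = Real.exp (-(κ * n)) * Real.exp (-κ * n) := by
    rw [← Real.exp_add]; ring_nf
  rw [h4, ← mul_assoc]
  exact mul_le_of_le_one_left (Real.exp_pos _).le h3

end CompactRouting

namespace CompactRouting

/-! ### Atypical graphs -/

open Classical in
theorem neighbourLabels_eq_map {n : ℕ} (G : SimpleGraph (Fin n)) (u : Fin n) :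
    neighbourLabels G u = ((List.finRange n).filter fun v => G.Adj u v).map Fin.val := by
  simp only [neighbourLabels, List.map_id', List.bind_eq_flatMap, List.pure_def]
  exact (List.map_eq_flatMap ..).symm

open Classical in
/-- The labels of the neighbours of `u` in the graph on `n` nodes with the list of edges `a`. -/
noncomputable def labelsOfEdges (n : ℕ) (a : List (ℕ × ℕ)) (u : ℕ) : List ℕ :=
  (List.range n).filter fun v => HasEdge a u v

theorem neighbourLabels_graphOfEdges (n : ℕ) (a : List (ℕ × ℕ)) (u : Fin n) :
    neighbourLabels (graphOfEdges n a) u = labelsOfEdges n a u := by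
  classical
  rw [neighbourLabels_eq_map, labelsOfEdges, ← map_val_finRange, List.filter_map]
  rfl

theorem primrec_labelsOfEdges {α : Type*} [Primcodable α] {n u : α → ℕ}
    {a : α → List (ℕ × ℕ)} (hn : Primrec n) (ha : Primrec a) (hu : Primrec u) :
    Primrec fun x => labelsOfEdges (n x) (a x) (u x) := by
  classical
  have h : PrimrecRel fun (v : ℕ) (q : List (ℕ × ℕ) × ℕ) => HasEdge q.1 q.2 v :=
    primrecPred_hasEdge (Primrec.fst.comp Primrec.snd) (Primrec.snd.comp Primrec.snd) Primrec.fst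
  exact h.listFilter.comp (Primrec.list_range.comp hn) (ha.pair hu)

theorem length_neighbourLabels {n : ℕ} (G : SimpleGraph (Fin n)) (u : Fin n) :
    (neighbourLabels G u).length = (nbrs G u).card := by
  classical
  rw [neighbourLabels_eq_map, List.length_map, nbrs, ← List.toFinset_card_of_nodup
    ((List.nodup_finRange n).filter _)]
  congr 1
  ext v
  simp

/-- Graphs with a node whose degree differs from `n / 2` by at least `n / (2 * K)`. -/
def irregularGraphs (K n : ℕ) : Set (SimpleGraph (Fin n)) :=
  {G | ∃ u, (K + 1) * n ≤ 2 * K * (nbrs G u).card ∨ 2 * K * (nbrs G u).card + n ≤ K * n}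

/-- Graphs with nonadjacent nodes `u` and `w` without common neighbour, where the degree of `u` is
at least `n / 4`. -/
def separatedGraphs (n : ℕ) : Set (SimpleGraph (Fin n)) :=
  {G | ∃ u w, u ≠ w ∧ ¬G.Adj u w ∧ n ≤ 4 * (nbrs G u).card ∧ ∀ v, ¬(G.Adj u v ∧ G.Adj v w)}

/-- Graphs with a node `u` of degree at most `n / 2 + n / (2 * K)` at which a string `s` of length
at most `n / 2 - 3 * n / (2 * K)` provides a common neighbour of `u` and `w` for every `w` not
adjacent to `u`. -/
def terselyRoutedGraphs (D : Interpreter) (K n : ℕ) : Set (SimpleGraph (Fin n)) :=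
  {G | ∃ (u : Fin n) (s : List Bool), 2 * K * (nbrs G u).card ≤ (K + 1) * n ∧
    2 * K * s.length + 3 * n ≤ K * n ∧ ∀ w : Fin n, w ≠ u → ¬G.Adj u w →
      ∃ v : Fin n, (v : ℕ) ∈ D s (n, (u : ℕ), neighbourLabels G u, (w : ℕ)) ∧
        G.Adj u v ∧ G.Adj v w}

theorem isSemidecidable_irregularGraphs (K : ℕ) : IsSemidecidable (irregularGraphs K) := by
  refine isSemidecidable_of_witness (fun q : ℕ × List (ℕ × ℕ) × ℕ => q.2.2 < q.1 ∧
    ((K + 1) * q.1 ≤ 2 * K * (labelsOfEdges q.1 q.2.1 q.2.2).length ∨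
      2 * K * (labelsOfEdges q.1 q.2.1 q.2.2).length + q.1 ≤ K * q.1)) ?_ fun n a => ?_
  · have hn : Primrec fun q : ℕ × List (ℕ × ℕ) × ℕ => q.1 := Primrec.fst
    have hu : Primrec fun q : ℕ × List (ℕ × ℕ) × ℕ => q.2.2 := Primrec.snd.comp Primrec.snd
    have hl := Primrec.nat_mul.comp (Primrec.const (2 * K)) (Primrec.list_length.comp
      (primrec_labelsOfEdges hn (Primrec.fst.comp Primrec.snd) hu))
    exact (Primrec.nat_lt.comp hu hn).and
      ((Primrec.nat_le.comp (Primrec.nat_mul.comp (Primrec.const (K + 1)) hn) hl).or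
        (Primrec.nat_le.comp (Primrec.nat_add.comp hl hn)
          (Primrec.nat_mul.comp (Primrec.const K) hn)))
  · simp only [irregularGraphs, Set.mem_ofPred_eq, ← length_neighbourLabels,
      neighbourLabels_graphOfEdges]
    constructor
    · rintro ⟨u, hu⟩
      exact ⟨u, u.2, hu⟩
    · rintro ⟨u, hun, hu⟩
      exact ⟨⟨u, hun⟩, hu⟩

theorem isSemidecidable_separatedGraphs : IsSemidecidable separatedGraphs := by
  refine isSemidecidable_of_witness (fun q : ℕ × List (ℕ × ℕ) × ℕ × ℕ =>
    q.2.2.1 < q.1 ∧ q.2.2.2 < q.1 ∧ q.2.2.1 ≠ q.2.2.2 ∧ ¬HasEdge q.2.1 q.2.2.1 q.2.2.2 ∧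
    q.1 ≤ 4 * (labelsOfEdges q.1 q.2.1 q.2.2.1).length ∧
    ∀ v ∈ List.range q.1, ¬(HasEdge q.2.1 q.2.2.1 v ∧ HasEdge q.2.1 v q.2.2.2)) ?_ fun n a => ?_
  · have hn : Primrec fun q : ℕ × List (ℕ × ℕ) × ℕ × ℕ => q.1 := Primrec.fst
    have ha : Primrec fun q : ℕ × List (ℕ × ℕ) × ℕ × ℕ => q.2.1 := Primrec.fst.comp Primrec.snd
    have hu : Primrec fun q : ℕ × List (ℕ × ℕ) × ℕ × ℕ => q.2.2.1 :=
      Primrec.fst.comp (Primrec.snd.comp Primrec.snd)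
    have hw : Primrec fun q : ℕ × List (ℕ × ℕ) × ℕ × ℕ => q.2.2.2 :=
      Primrec.snd.comp (Primrec.snd.comp Primrec.snd)
    have hR : PrimrecRel fun (v : ℕ) (q : ℕ × List (ℕ × ℕ) × ℕ × ℕ) =>
        ¬(HasEdge q.2.1 q.2.2.1 v ∧ HasEdge q.2.1 v q.2.2.2) :=
      ((primrecPred_hasEdge (ha.comp Primrec.snd) (hu.comp Primrec.snd) Primrec.fst).and
        (primrecPred_hasEdge (ha.comp Primrec.snd) Primrec.fst (hw.comp Primrec.snd))).not
    exact (Primrec.nat_lt.comp hu hn).and ((Primrec.nat_lt.comp hw hn).and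
      ((Primrec.eq.comp hu hw).not.and ((primrecPred_hasEdge ha hu hw).not.and
        ((Primrec.nat_le.comp hn (Primrec.nat_mul.comp (Primrec.const 4)
          (Primrec.list_length.comp (primrec_labelsOfEdges hn ha hu)))).and
          (hR.forall_mem_list.comp (Primrec.list_range.comp hn) Primrec.id)))))
  · simp only [separatedGraphs, Set.mem_ofPred_eq, ← length_neighbourLabels,
      neighbourLabels_graphOfEdges, List.mem_range]
    constructor
    · rintro ⟨u, w, huw, hadj, hd, hv⟩
      exact ⟨(u, w), u.2, w.2, fun h => huw (Fin.ext h), hadj, hd, fun v hvn => hv ⟨v, hvn⟩⟩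
    · rintro ⟨⟨u, w⟩, hu, hw, huw, hadj, hd, hv⟩
      exact ⟨⟨u, hu⟩, ⟨w, hw⟩, fun h => huw (Fin.mk.inj h), hadj, hd, fun v => hv v v.2⟩

/-- The values of a partial recursive interpreter are found by a step-bounded primitive recursive
search. -/
theorem exists_stepped_interpreter {D : Interpreter} (hD : Partrec₂ D) :
    ∃ E : ℕ × List Bool × (ℕ × ℕ × List ℕ × ℕ) → Option ℕ, Primrec E ∧
      (∀ t t' s y v, t ≤ t' → E (t, s, y) = some v → E (t', s, y) = some v) ∧
      ∀ s y v, v ∈ D s y ↔ ∃ t, E (t, s, y) = some v := by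
  obtain ⟨c, hc⟩ := Nat.Partrec.Code.exists_code.1 hD
  refine ⟨fun q => Nat.Partrec.Code.evaln q.1 c (Encodable.encode q.2), ?_, ?_, ?_⟩
  · exact Nat.Partrec.Code.primrec_evaln.comp ((Primrec.fst.pair (Primrec.const c)).pair
      (Primrec.encode.comp Primrec.snd))
  · intro t t' s y v htt h
    exact Nat.Partrec.Code.evaln_mono htt h
  · intro s y v
    have h1 : v ∈ D s y ↔ v ∈ c.eval (Encodable.encode (s, y)) := by
      simp only [hc, Encodable.encodek, Part.coe_some, Part.bind_some, Part.mem_map_iff,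
        Encodable.encode_nat, exists_eq_right]
    rw [h1, Nat.Partrec.Code.evaln_complete]
    rfl

/-- Since `D` may diverge, the witness contains, besides the node and its string, a step bound
within which `D` answers for all relevant destinations. -/
theorem isSemidecidable_terselyRoutedGraphs {D : Interpreter} (hD : Partrec₂ D) (K : ℕ) :
    IsSemidecidable (terselyRoutedGraphs D K) := by
  obtain ⟨E, hE, hmono, hDE⟩ := exists_stepped_interpreter hD
  refine isSemidecidable_of_witness (fun q : ℕ × List (ℕ × ℕ) × ℕ × List Bool × ℕ =>
    q.2.2.1 < q.1 ∧ 2 * K * (labelsOfEdges q.1 q.2.1 q.2.2.1).length ≤ (K + 1) * q.1 ∧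
    2 * K * q.2.2.2.1.length + 3 * q.1 ≤ K * q.1 ∧
    ∀ w ∈ List.range q.1, w = q.2.2.1 ∨ HasEdge q.2.1 q.2.2.1 w ∨ ∃ v ∈ List.range q.1,
      E (q.2.2.2.2, q.2.2.2.1, q.1, q.2.2.1, labelsOfEdges q.1 q.2.1 q.2.2.1, w) = some v ∧
        HasEdge q.2.1 q.2.2.1 v ∧ HasEdge q.2.1 v w) ?_ fun n a => ?_
  · have hn : Primrec fun q : ℕ × List (ℕ × ℕ) × ℕ × List Bool × ℕ => q.1 := Primrec.fst
    have ha : Primrec fun q : ℕ × List (ℕ × ℕ) × ℕ × List Bool × ℕ => q.2.1 :=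
      Primrec.fst.comp Primrec.snd
    have hu : Primrec fun q : ℕ × List (ℕ × ℕ) × ℕ × List Bool × ℕ => q.2.2.1 :=
      Primrec.fst.comp (Primrec.snd.comp Primrec.snd)
    have hs : Primrec fun q : ℕ × List (ℕ × ℕ) × ℕ × List Bool × ℕ => q.2.2.2.1 :=
      Primrec.fst.comp (Primrec.snd.comp (Primrec.snd.comp Primrec.snd))
    have ht : Primrec fun q : ℕ × List (ℕ × ℕ) × ℕ × List Bool × ℕ => q.2.2.2.2 :=
      Primrec.snd.comp (Primrec.snd.comp (Primrec.snd.comp Primrec.snd))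
    have hl := primrec_labelsOfEdges hn ha hu
    have hR : PrimrecRel fun (v : ℕ) (x : ℕ × ℕ × List (ℕ × ℕ) × ℕ × List Bool × ℕ) =>
        E (x.2.2.2.2.2, x.2.2.2.2.1, x.2.1, x.2.2.2.1, labelsOfEdges x.2.1 x.2.2.1 x.2.2.2.1,
          x.1) = some v ∧ HasEdge x.2.2.1 x.2.2.2.1 v ∧ HasEdge x.2.2.1 v x.1 := by
      have p := Primrec.snd.comp (Primrec.snd (α := ℕ)
        (β := ℕ × ℕ × List (ℕ × ℕ) × ℕ × List Bool × ℕ))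
      have hw := Primrec.fst.comp (Primrec.snd (α := ℕ)
        (β := ℕ × ℕ × List (ℕ × ℕ) × ℕ × List Bool × ℕ))
      exact (Primrec.eq.comp (hE.comp ((ht.comp p).pair ((hs.comp p).pair ((hn.comp p).pair
        ((hu.comp p).pair ((hl.comp p).pair hw)))))) (Primrec.option_some.comp Primrec.fst)).and
        ((primrecPred_hasEdge (ha.comp p) (hu.comp p) Primrec.fst).and
          (primrecPred_hasEdge (ha.comp p) Primrec.fst hw))
    have hR' : PrimrecRel fun (w : ℕ) (q : ℕ × List (ℕ × ℕ) × ℕ × List Bool × ℕ) =>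
        w = q.2.2.1 ∨ HasEdge q.2.1 q.2.2.1 w ∨ ∃ v ∈ List.range q.1,
          E (q.2.2.2.2, q.2.2.2.1, q.1, q.2.2.1, labelsOfEdges q.1 q.2.1 q.2.2.1, w) = some v ∧
            HasEdge q.2.1 q.2.2.1 v ∧ HasEdge q.2.1 v w :=
      (Primrec.eq.comp Primrec.fst (hu.comp Primrec.snd)).or
        ((primrecPred_hasEdge (ha.comp Primrec.snd) (hu.comp Primrec.snd) Primrec.fst).or
          (hR.exists_mem_list.comp (Primrec.list_range.comp (hn.comp Primrec.snd)) Primrec.id))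
    exact (Primrec.nat_lt.comp hu hn).and
      ((Primrec.nat_le.comp
          (Primrec.nat_mul.comp (Primrec.const (2 * K)) (Primrec.list_length.comp hl))
          (Primrec.nat_mul.comp (Primrec.const (K + 1)) hn)).and
        ((Primrec.nat_le.comp
          (Primrec.nat_add.comp
            (Primrec.nat_mul.comp (Primrec.const (2 * K)) (Primrec.list_length.comp hs))
            (Primrec.nat_mul.comp (Primrec.const 3) hn))
          (Primrec.nat_mul.comp (Primrec.const K) hn)).and
          (hR'.forall_mem_list.comp (Primrec.list_range.comp hn) Primrec.id)))
  · simp only [terselyRoutedGraphs, Set.mem_ofPred_eq, ← length_neighbourLabels,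
      neighbourLabels_graphOfEdges, List.mem_range]
    constructor
    · rintro ⟨u, s, hd, hs, hw⟩
      have hsteps : ∀ w : Fin n, ∃ t, w = u ∨ HasEdge a u w ∨ ∃ v < n,
          E (t, s, n, u, labelsOfEdges n a u, w) = some v ∧ HasEdge a u v ∧ HasEdge a v w := by
        intro w
        by_cases h1 : w = u
        · exact ⟨0, Or.inl h1⟩
        by_cases h2 : HasEdge a u w
        · exact ⟨0, Or.inr (Or.inl h2)⟩
        obtain ⟨v, hv, huv, hvw⟩ := hw w h1 h2
        obtain ⟨t, ht⟩ := (hDE _ _ _).1 hv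
        exact ⟨t, Or.inr (Or.inr ⟨v, v.2, ht, huv, hvw⟩)⟩
      choose t ht using hsteps
      -- There are finitely many destinations, so the largest of their step bounds serves all, by
      -- monotonicity of `E`.
      refine ⟨(u, s, Finset.univ.sup t), u.2, hd, hs, fun w hwn => ?_⟩
      rcases ht ⟨w, hwn⟩ with h | h | ⟨v, hv, hE', hadj⟩
      · exact Or.inl (congrArg Fin.val h)
      · exact Or.inr (Or.inl h)
      · exact Or.inr (Or.inr ⟨v, hv,
          hmono _ _ _ _ _ (Finset.le_sup (Finset.mem_univ _)) hE', hadj⟩)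
    · rintro ⟨⟨u, s, t⟩, hu, hd, hs, hw⟩
      refine ⟨⟨u, hu⟩, s, hd, hs, fun w hwu hadj => ?_⟩
      rcases hw w w.2 with h | h | ⟨v, hv, hE', huv, hvw⟩
      · exact absurd (Fin.ext h) hwu
      · exact absurd h hadj
      · exact ⟨⟨v, hv⟩, (hDE _ _ _).2 ⟨t, hE'⟩, huv, hvw⟩

end CompactRouting

/-! ### Exponential smallness of the atypical families -/

namespace CompactRouting

open Finset Filter

/-- The neighbourhood of `u` in a uniform graph is a uniform subset of the other `n - 1` nodes, so
the Chernoff bound for subsets carries over to graphs. -/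
theorem card_le_of_degree_deviation {n : ℕ} (𝓑 : Finset (SimpleGraph (Fin n))) (u : Fin n)
    (η t : ℝ) (h : ∀ G ∈ 𝓑, t ≤ η * (2 * ((nbrs G u).card : ℝ) - (n - 1))) :
    (𝓑.card : ℝ) ≤ 2 ^ n.choose 2 * Real.exp ((n - 1) * (η ^ 2 / 2) - t) := by
  classical
  have hn : 1 ≤ n := u.pos
  have hs : ((univ : Finset (Fin n)).erase u).card = n - 1 := by
    rw [card_erase_of_mem (mem_univ u), card_univ, Fintype.card_fin]
  have h1 : ((𝓑.card * 2 ^ (n - 1) : ℕ) : ℝ) ≤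
      ((𝓑.image fun G => nbrs G u).card * 2 ^ n.choose 2 : ℕ) := by
    exact_mod_cast card_mul_two_pow_le_card_mul 𝓑 u _ fun G hG => mem_image_of_mem _ hG
  have h2 := card_le_of_weight ((univ : Finset (Fin n)).erase u) (𝓑.image fun G => nbrs G u) η t
    (by
      intro A hA
      obtain ⟨G, hG, rfl⟩ := mem_image.1 hA
      refine ⟨fun v hv => mem_erase.2 ⟨?_, mem_univ v⟩, ?_⟩
      · exact (mem_nbrs.1 hv).ne'
      · rw [hs, Nat.cast_sub hn, Nat.cast_one]
        exact h G hG)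
  rw [hs, Nat.cast_sub hn, Nat.cast_one] at h2
  push_cast at h1
  refine le_of_mul_le_mul_right ?_ (show (0 : ℝ) < 2 ^ (n - 1) by positivity)
  calc _ ≤ _ := h1
    _ ≤ _ := mul_le_mul_of_nonneg_right h2 (by positivity)
    _ = _ := by ring

theorem eventually_ncard_irregularGraphs_le {K : ℕ} (hK : 1 ≤ K) :
    ∀ᶠ n : ℕ in atTop, ((irregularGraphs K n).ncard : ℝ) ≤
      2 ^ n.choose 2 * Real.exp (-(1 / (4 * (K : ℝ) ^ 2)) * n) := by
  classical
  have hK' : (1 : ℝ) ≤ K := by exact_mod_cast hK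
  filter_upwards [eventually_poly_mul_exp_le (2 * Real.exp 1) 1
    (show 0 < 1 / (4 * (K : ℝ) ^ 2) by positivity)] with n hn
  let B : Fin n × Bool → Finset (SimpleGraph (Fin n)) := fun i => univ.filter fun G =>
    if i.2 then (K + 1) * n ≤ 2 * K * (nbrs G i.1).card
    else 2 * K * (nbrs G i.1).card + n ≤ K * n
  -- The choice `η = ±1 / K` leaves the rate `1 / (2 * K ^ 2)`, twice the one claimed. The `- 1` in
  -- `n / K - 1` allows for the mean degree being `(n - 1) / 2`; its cost `1 / K ≤ 1` becomes the
  -- factor `exp 1`.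
  have hexp : ∀ x : ℝ, x = 1 / K ∨ x = -(1 / K) → Real.exp ((n - 1) * (x ^ 2 / 2) -
      1 / K * (n / K - 1)) ≤ Real.exp 1 * Real.exp (-(2 * (1 / (4 * (K : ℝ) ^ 2))) * n) := by
    intro x hx
    have hx2 : x ^ 2 = 1 / (K : ℝ) ^ 2 := by rcases hx with rfl | rfl <;> ring
    rw [← Real.exp_add, Real.exp_le_exp, hx2]
    have h1 : 1 / (K : ℝ) ≤ 1 := (div_le_one (by positivity)).2 hK'
    have h2 : 0 ≤ 1 / (K : ℝ) ^ 2 := by positivity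
    have h3 : 1 / (K : ℝ) * (n / K - 1) = n * (1 / (K : ℝ) ^ 2) - 1 / K := by
      field_simp
    have h4 : 1 / (4 * (K : ℝ) ^ 2) = 1 / (K : ℝ) ^ 2 / 4 := by field_simp
    rw [h3, h4]
    linarith
  have hM : ∀ i, ((B i).card : ℝ) ≤ 2 ^ n.choose 2 *
      (Real.exp 1 * Real.exp (-(2 * (1 / (4 * (K : ℝ) ^ 2))) * n)) := by
    rintro ⟨u, _ | _⟩
    · refine (card_le_of_degree_deviation _ u (-(1 / K)) (1 / K * (n / K - 1)) ?_).trans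
        (mul_le_mul_of_nonneg_left (hexp _ (Or.inr rfl)) (by positivity))
      intro G hG
      have h : 2 * K * (nbrs G u).card + n ≤ K * n := by simpa [B] using hG
      have h' : 2 * (K : ℝ) * (nbrs G u).card + n ≤ K * n := by exact_mod_cast h
      rw [neg_mul, ← mul_neg]
      refine mul_le_mul_of_nonneg_left ?_ (by positivity)
      have h5 : (n : ℝ) / K ≤ n - 2 * (nbrs G u).card := by
        rw [div_le_iff₀ (by positivity)]; linarith
      linarith
    · refine (card_le_of_degree_deviation _ u (1 / K) (1 / K * (n / K - 1)) ?_).trans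
        (mul_le_mul_of_nonneg_left (hexp _ (Or.inl rfl)) (by positivity))
      intro G hG
      have h : (K + 1) * n ≤ 2 * K * (nbrs G u).card := by simpa [B] using hG
      have h' : ((K : ℝ) + 1) * n ≤ 2 * K * (nbrs G u).card := by exact_mod_cast h
      refine mul_le_mul_of_nonneg_left ?_ (by positivity)
      have h5 : (n : ℝ) / K ≤ 2 * (nbrs G u).card - n := by
        rw [div_le_iff₀ (by positivity)]; linarith
      linarith
  have hB : ∀ G ∈ irregularGraphs K n, ∃ i, G ∈ B i := by
    rintro G ⟨u, h | h⟩
    · exact ⟨(u, true), by simpa [B] using h⟩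
    · exact ⟨(u, false), by simpa [B] using h⟩
  refine (ncard_le_card_mul _ B hB _ hM).trans ?_
  rw [Fintype.card_prod, Fintype.card_fin, Fintype.card_bool]
  push_cast
  calc _ = 2 ^ n.choose 2 * (2 * Real.exp 1 * (n : ℝ) ^ 1 *
        Real.exp (-(2 * (1 / (4 * (K : ℝ) ^ 2))) * n)) := by ring
    _ ≤ _ := mul_le_mul_of_nonneg_left hn (by positivity)

theorem two_rpow_eq_exp (x : ℝ) : (2 : ℝ) ^ x = Real.exp (Real.log 2 * x) :=
  Real.rpow_def_of_pos two_pos x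

theorem eventually_ncard_separatedGraphs_le :
    ∀ᶠ n : ℕ in atTop, ((separatedGraphs n).ncard : ℝ) ≤
      2 ^ n.choose 2 * Real.exp (-(Real.log 2 / 8) * n) := by
  classical
  have hl0 : 0 < Real.log 2 := Real.log_pos one_lt_two
  filter_upwards [eventually_poly_mul_exp_le 2 2
    (show 0 < Real.log 2 / 8 by positivity)] with n hn
  let B : Fin n × Fin n → Finset (SimpleGraph (Fin n)) := fun i => univ.filter fun G =>
    i.1 ≠ i.2 ∧ ¬G.Adj i.1 i.2 ∧ n ≤ 4 * (nbrs G i.1).card ∧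
      ∀ v, ¬(G.Adj i.1 v ∧ G.Adj v i.2)
  -- The factor `2` pays for rounding down in `n / 4`.
  have hpow : (1 : ℝ) ≤ 2 ^ (n / 4) * (2 * Real.exp (-(2 * (Real.log 2 / 8)) * n)) := by
    have h1 : ((n : ℝ) - 4) / 4 ≤ ((n / 4 : ℕ) : ℝ) := by
      have : n ≤ 4 * (n / 4) + 4 := by omega
      have : (n : ℝ) ≤ 4 * ((n / 4 : ℕ) : ℝ) + 4 := by exact_mod_cast this
      linarith
    have h2 : (2 : ℝ) = Real.exp (Real.log 2) := (Real.exp_log two_pos).symm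
    rw [← Real.rpow_natCast, two_rpow_eq_exp]
    nth_rw 2 [h2]
    rw [← Real.exp_add, ← Real.exp_add]
    refine Real.one_le_exp ?_
    have := mul_le_mul_of_nonneg_left h1 hl0.le
    linarith
  have hM : ∀ i, ((B i).card : ℝ) ≤ 2 ^ n.choose 2 *
      (2 * Real.exp (-(2 * (Real.log 2 / 8)) * n)) := by
    rintro ⟨u, w⟩
    by_cases huw : u = w
    · have : B (u, w) = ∅ := by simp [B, huw]
      rw [this, card_empty, Nat.cast_zero]
      positivity
    have h1 := card_noCommonNeighbour_mul_le (B (u, w)) u w (n / 4) huw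
      (fun G hG => (mem_filter.1 hG).2.2.1)
      (fun G hG => by have := (mem_filter.1 hG).2.2.2.1; simp only at this; omega)
      (fun G hG => (mem_filter.1 hG).2.2.2.2)
    have h2 : ((B (u, w)).card : ℝ) * 2 ^ (n / 4) ≤ 2 ^ n.choose 2 := by exact_mod_cast h1
    calc ((B (u, w)).card : ℝ) ≤ (B (u, w)).card *
          (2 ^ (n / 4) * (2 * Real.exp (-(2 * (Real.log 2 / 8)) * n))) :=
          le_mul_of_one_le_right (by positivity) hpow
      _ = (B (u, w)).card * 2 ^ (n / 4) * (2 * Real.exp (-(2 * (Real.log 2 / 8)) * n)) := by ring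
      _ ≤ _ := mul_le_mul_of_nonneg_right h2 (by positivity)
  have hB : ∀ G ∈ separatedGraphs n, ∃ i, G ∈ B i := by
    rintro G ⟨u, w, h⟩
    exact ⟨(u, w), mem_filter.2 ⟨mem_univ _, h⟩⟩
  refine (ncard_le_card_mul _ B hB _ hM).trans ?_
  rw [Fintype.card_prod, Fintype.card_fin]
  push_cast
  calc _ = 2 ^ n.choose 2 * (2 * (n : ℝ) ^ 2 *
        Real.exp (-(2 * (Real.log 2 / 8)) * n)) := by ring
    _ ≤ _ := mul_le_mul_of_nonneg_left hn (by positivity)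

/-- The graphs in which a fixed string at `u` provides common neighbours of `u` and all nodes not
adjacent to `u`. -/
theorem card_terselyRouted_mul_le {n : ℕ} (D : Interpreter) (𝓑 : Finset (SimpleGraph (Fin n)))
    (u : Fin n) (s : List Bool) (b : ℕ) (hb : ∀ G ∈ 𝓑, b + (nbrs G u).card + 1 ≤ n)
    (hs : ∀ G ∈ 𝓑, ∀ w : Fin n, w ≠ u → ¬G.Adj u w →
      ∃ v : Fin n, (v : ℕ) ∈ D s (n, (u : ℕ), neighbourLabels G u, (w : ℕ)) ∧
        G.Adj u v ∧ G.Adj v w) :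
    𝓑.card * 2 ^ b ≤ 2 ^ n.choose 2 := by
  classical
  let labels : Finset (Fin n) → List ℕ := fun A =>
    ((List.finRange n).filter fun v => v ∈ A).map Fin.val
  have hlabels : ∀ G : SimpleGraph (Fin n), labels (nbrs G u) = neighbourLabels G u := by
    intro G
    rw [neighbourLabels_eq_map]
    simp [labels]
  -- For fixed `s`, the interpreter sees the graph only through the neighbours of `u`, so its answer
  -- is a function of that set. The default `w` is never reached where `φ` is used.
  let φ : Finset (Fin n) → Fin n → Fin n := fun A w =>
    if h : ∃ v : Fin n, (v : ℕ) ∈ D s (n, (u : ℕ), labels A, (w : ℕ)) then h.choose else w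
  refine card_intermediate_mul_le 𝓑 u b φ (fun G hG w hwu hadj => ?_) hb
  obtain ⟨v, hv, h⟩ := hs G hG w hwu hadj
  rw [← hlabels] at hv
  have hex : ∃ v : Fin n, (v : ℕ) ∈ D s (n, (u : ℕ), labels (nbrs G u), (w : ℕ)) := ⟨v, hv⟩
  have hφ : φ (nbrs G u) w = v := by
    simp only [φ, dif_pos hex]
    exact Fin.ext (Part.mem_unique hex.choose_spec hv)
  rwa [hφ]

/-- Strings of length at most `m` are indexed by a length and `m` padded bits, at most `(m + 1) * 2
^ m` in number. -/
theorem exists_take_ofFn_eq {m : ℕ} (s : List Bool) (hs : s.length ≤ m) :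
    ∃ (i : Fin (m + 1)) (f : Fin m → Bool), (List.ofFn f).take i = s := by
  refine ⟨⟨s.length, by omega⟩, fun j => s.getD j false, ?_⟩
  refine List.ext_getElem (by simp [hs]) fun j h1 h2 => ?_
  simp [h2]

theorem eventually_ncard_terselyRoutedGraphs_le (D : Interpreter) {K : ℕ} (hK : 3 ≤ K) :
    ∀ᶠ n : ℕ in atTop, ((terselyRoutedGraphs D K n).ncard : ℝ) ≤
      2 ^ n.choose 2 * Real.exp (-(Real.log 2 / (2 * K)) * n) := by
  classical
  have hK' : (3 : ℝ) ≤ K := by exact_mod_cast hK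
  have hl0 : 0 < Real.log 2 := Real.log_pos one_lt_two
  filter_upwards [eventually_poly_mul_exp_le 8 2
    (show 0 < Real.log 2 / (2 * K) by positivity), eventually_ge_atTop 1] with n hn hn1
  -- `m` bounds the string length and `b` the number of non-neighbours from below; the `- 1` in `b`
  -- excludes `u` itself. Up to rounding, `b` exceeds `m` by `n / K`, and this gap is the gain.
  set m := (K * n - 3 * n) / (2 * K) with hm
  set b := (K * n - n) / (2 * K) - 1 with hb
  have h3 : 3 * n ≤ K * n := Nat.mul_le_mul_right n hK
  have hmn : m + 1 ≤ n := by
    have : m < n := by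
      rw [hm, Nat.div_lt_iff_lt_mul (by omega)]
      have : n * (2 * K) = 2 * (K * n) := by ring
      omega
    omega
  let B : Fin n × Fin (m + 1) × (Fin m → Bool) → Finset (SimpleGraph (Fin n)) := fun i =>
    univ.filter fun G => b + (nbrs G i.1).card + 1 ≤ n ∧ ∀ w : Fin n, w ≠ i.1 → ¬G.Adj i.1 w →
      ∃ v : Fin n, (v : ℕ) ∈ D ((List.ofFn i.2.2).take i.2.1)
        (n, (i.1 : ℕ), neighbourLabels G i.1, (w : ℕ)) ∧ G.Adj i.1 v ∧ G.Adj v w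
  have hpow : (2 : ℝ) ^ m ≤ 2 ^ b * (8 * Real.exp (-(2 * (Real.log 2 / (2 * K))) * n)) := by
    have hm' : (m : ℝ) * (2 * K) ≤ K * n - 3 * n := by
      have : m * (2 * K) + 3 * n ≤ K * n := by
        have := Nat.div_mul_le_self (K * n - 3 * n) (2 * K)
        rw [← hm] at this
        omega
      have : (m : ℝ) * (2 * K) + 3 * n ≤ K * n := by exact_mod_cast this
      linarith
    have hb' : (K : ℝ) * n - n ≤ (b + 2) * (2 * K) := by
      have h4 := Nat.lt_div_mul_add (a := K * n - n) (b := 2 * K) (by omega)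
      have h5 : (K * n - n) / (2 * K) * (2 * K) ≤ (b + 1) * (2 * K) :=
        Nat.mul_le_mul_right _ (by omega)
      have h6 : K * n ≤ (b + 2) * (2 * K) + n := by
        have : (b + 2) * (2 * K) = (b + 1) * (2 * K) + 2 * K := by ring
        omega
      have : (K : ℝ) * n ≤ (b + 2) * (2 * K) + n := by exact_mod_cast h6
      linarith
    have h7 : (m : ℝ) ≤ b + 3 - n / K := by
      refine le_of_mul_le_mul_right (a := 2 * (K : ℝ)) ?_ (by positivity)
      have : (b + 3 - (n : ℝ) / K) * (2 * K) = (b + 2) * (2 * K) + 2 * K - 2 * n := by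
        field_simp
        ring
      linarith
    -- The factor `8 = 2 ^ 3` covers the three bits lost in `h7`.
    have h8 : (8 : ℝ) = Real.exp (Real.log 2 * 3) := by
      rw [← two_rpow_eq_exp]
      norm_num
    rw [← Real.rpow_natCast, ← Real.rpow_natCast, two_rpow_eq_exp, two_rpow_eq_exp, h8,
      ← Real.exp_add, ← Real.exp_add, Real.exp_le_exp]
    calc _ ≤ _ := mul_le_mul_of_nonneg_left h7 hl0.le
      _ = _ := by
        field_simp
        ring
  have hM : ∀ i, ((B i).card : ℝ) ≤ 2 ^ n.choose 2 / 2 ^ b := by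
    rintro ⟨u, i, f⟩
    rw [le_div_iff₀ (by positivity)]
    exact_mod_cast card_terselyRouted_mul_le D (B (u, i, f)) u ((List.ofFn f).take i) b
      (fun G hG => (mem_filter.1 hG).2.1) (fun G hG => (mem_filter.1 hG).2.2)
  have hB : ∀ G ∈ terselyRoutedGraphs D K n, ∃ i, G ∈ B i := by
    rintro G ⟨u, s, hd, hs, h⟩
    obtain ⟨i, f, rfl⟩ := exists_take_ofFn_eq (m := m) s (by
      rw [hm, Nat.le_div_iff_mul_le (by omega)]
      have : s.length * (2 * K) = 2 * K * s.length := by ring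
      omega)
    refine ⟨(u, i, f), mem_filter.2 ⟨mem_univ _, ?_, h⟩⟩
    change b + (nbrs G u).card + 1 ≤ n
    have hd' : (nbrs G u).card * (2 * K) ≤ K * n + n := by linarith
    have hq := Nat.div_mul_le_self (K * n - n) (2 * K)
    have hnK : n * (2 * K) = 2 * (K * n) := by ring
    -- If the quotient is `0`, the truncated subtraction gives `b = 0`, and only degree less than
    -- `n` is needed.
    rcases Nat.eq_zero_or_pos ((K * n - n) / (2 * K)) with h0 | h0
    · have : (nbrs G u).card < n := lt_of_mul_lt_mul_right (a := 2 * K) (by omega) (Nat.zero_le _)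
      omega
    · have : (K * n - n) / (2 * K) + (nbrs G u).card ≤ n := by
        refine le_of_mul_le_mul_right (a := 2 * K) ?_ (by omega)
        rw [add_mul]
        omega
      omega
  refine (ncard_le_card_mul _ B hB _ hM).trans ?_
  rw [Fintype.card_prod, Fintype.card_prod, Fintype.card_fin, Fintype.card_fin, Fintype.card_fun,
    Fintype.card_bool, Fintype.card_fin]
  push_cast
  have hmn' : (m : ℝ) + 1 ≤ n := by exact_mod_cast hmn
  calc (n : ℝ) * ((m + 1) * 2 ^ m) * (2 ^ n.choose 2 / 2 ^ b)
      ≤ n * (n * (2 ^ b * (8 * Real.exp (-(2 * (Real.log 2 / (2 * K))) * n)))) *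
        (2 ^ n.choose 2 / 2 ^ b) := by gcongr
    _ = 2 ^ n.choose 2 * (8 * (n : ℝ) ^ 2 *
        Real.exp (-(2 * (Real.log 2 / (2 * K))) * n)) := by field_simp
    _ ≤ _ := mul_le_mul_of_nonneg_left hn (by positivity)

/-! ### From routes of length two to the lower bound -/

theorem adj_of_delivers_two {n : ℕ} {G : SimpleGraph (Fin n)} {F : Fin n → Fin n → Fin n}
    {u w : Fin n} (h : Delivers G F w 2 u) : G.Adj u (F u w) ∧ G.Adj (F u w) w := by
  cases h with
  | step h1 h2 h3 =>
    cases h3 with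
    | step h4 h5 h6 =>
      generalize hx : F (F u w) w = x at h5 h6
      cases h6
      exact ⟨h2, h5⟩

theorem dist_eq_two {n : ℕ} {G : SimpleGraph (Fin n)} {u v w : Fin n} (hne : w ≠ u)
    (hadj : ¬G.Adj u w) (huv : G.Adj u v) (hvw : G.Adj v w) :
    G.Reachable u w ∧ G.dist u w = 2 := by
  have hr : G.Reachable u w := huv.reachable.trans hvw.reachable
  refine ⟨hr, le_antisymm ?_ ?_⟩
  · simpa using SimpleGraph.dist_le (SimpleGraph.Walk.cons huv (SimpleGraph.Walk.cons hvw .nil))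
  · have h0 : G.dist u w ≠ 0 := fun h => hne (hr.dist_eq_zero_iff.1 h).symm
    have h1 : G.dist u w ≠ 1 := fun h => hadj (SimpleGraph.dist_eq_one_iff_adj.1 h)
    omega

/-- In random graphs, shortest path routing needs almost `n / 2` bits at each node. -/
theorem eventually_length_lower_bound {U : Machine} (hU : IsUniversal U) {D : Interpreter}
    (hD : Partrec₂ D) {δ : ℕ → ℝ} (hδ : δ =o[atTop] fun n : ℕ => (n : ℝ)) {K : ℕ}
    (hK : 3 ≤ K) :
    ∀ᶠ n : ℕ in atTop, ∀ (d : ℕ) (G : SimpleGraph (Fin n)), IsRandomGraph U δ d G →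
      ∀ F : Fin n → Fin n → Fin n, IsShortestPathScheme G F →
        ∀ (u : Fin n) (s : List Bool), Stores D G u s (F u) →
          K * n < 2 * K * s.length + 3 * n := by
  have hK' : (3 : ℝ) ≤ K := by exact_mod_cast hK
  have hl0 : 0 < Real.log 2 := Real.log_pos one_lt_two
  filter_upwards [
    eventually_notMem_of_isRandomGraph hU hδ (isSemidecidable_irregularGraphs K)
      (by positivity) (eventually_ncard_irregularGraphs_le (by omega)),
    eventually_notMem_of_isRandomGraph hU hδ isSemidecidable_separatedGraphs
      (by positivity) eventually_ncard_separatedGraphs_le,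
    eventually_notMem_of_isRandomGraph hU hδ (isSemidecidable_terselyRoutedGraphs hD K)
      (by positivity) (eventually_ncard_terselyRoutedGraphs_le D hK)]
    with n h1 h2 h3 d G hG F hF u s hs
  by_contra! hlen
  have hdeg : ¬((K + 1) * n ≤ 2 * K * (nbrs G u).card ∨
      2 * K * (nbrs G u).card + n ≤ K * n) := fun h => h1 d G hG ⟨u, h⟩
  push Not at hdeg
  refine h3 d G hG ⟨u, s, hdeg.1.le, hlen, fun w hwu hadj => ?_⟩
  have hcommon : ∃ v, G.Adj u v ∧ G.Adj v w := by
    by_contra! hno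
    refine h2 d G hG ⟨u, w, hwu.symm, hadj, ?_, fun v hv => hno v hv.1 hv.2⟩
    -- Regularity makes the degree exceed `(K - 1) * n / (2 * K)`, which is at least `n / 3` because
    -- `K ≥ 3`.
    nlinarith
  obtain ⟨v, huv, hvw⟩ := hcommon
  obtain ⟨hr, hdist⟩ := dist_eq_two hwu hadj huv hvw
  have hdel := hF u w hr
  rw [hdist] at hdel
  exact ⟨F u w, hs w hwu hr, adj_of_delivers_two hdel⟩

end CompactRouting

theorem mainTheorem2 (U : CompactRouting.Machine) (hU : CompactRouting.IsUniversal U)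
    (D : CompactRouting.Interpreter) (hD : Partrec₂ D)
    (δ : ℕ → ℝ) (hδ : δ =o[Filter.atTop] fun n : ℕ => (n : ℝ)) :
    ∃ f g : ℕ → ℝ,
      f =o[Filter.atTop] (fun n : ℕ => (n : ℝ)) ∧
      g =o[Filter.atTop] (fun n : ℕ => (n : ℝ) ^ 2) ∧
      ∀ (n d : ℕ) (G : SimpleGraph (Fin n)), CompactRouting.IsRandomGraph U δ d G →
        ∀ F : Fin n → Fin n → Fin n, CompactRouting.IsShortestPathScheme G F →
          (∀ (u : Fin n) (s : List Bool), CompactRouting.Stores D G u s (F u) →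
            (n : ℝ) / 2 - f n ≤ (s.length : ℝ)) ∧
          (∀ s : Fin n → List Bool, (∀ u, CompactRouting.Stores D G u (s u) (F u)) →
            (n : ℝ) ^ 2 / 2 - g n ≤ ∑ u, ((s u).length : ℝ)) := by
  -- All deficits that occur at size `n`. Taking `f n` as their supremum makes the bound hold for
  -- every `n`, small ones included; the added `0` keeps the set nonempty and the supremum
  -- nonnegative.
  let S : ℕ → Set ℝ := fun n => insert 0 {x | ∃ (d : ℕ) (G : SimpleGraph (Fin n))
    (F : Fin n → Fin n → Fin n) (u : Fin n) (s : List Bool),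
    CompactRouting.IsRandomGraph U δ d G ∧ CompactRouting.IsShortestPathScheme G F ∧
      CompactRouting.Stores D G u s (F u) ∧ x = (n : ℝ) / 2 - s.length}
  have hbdd : ∀ n, BddAbove (S n) := by
    refine fun n => ⟨(n : ℝ) / 2, ?_⟩
    rintro x (rfl | ⟨d, G, F, u, s, -, -, -, rfl⟩)
    · positivity
    · linarith [Nat.cast_nonneg (α := ℝ) s.length]
  have hf : (fun n => sSup (S n)) =o[Filter.atTop] (fun n : ℕ => (n : ℝ)) := by
    rw [Asymptotics.isLittleO_iff]
    intro c hc
    -- The deficit is below `3 * n / (2 * K)`, which is at most `c * n` once `K ≥ 3 / (2 * c)`; the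
    -- summand `3` ensures `K ≥ 3`.
    obtain ⟨K, hK⟩ := exists_nat_ge (3 + 3 / (2 * c))
    have hK3 : 3 ≤ K := by
      have : (3 : ℝ) ≤ K := le_trans (by linarith [show 0 ≤ 3 / (2 * c) by positivity]) hK
      exact_mod_cast this
    filter_upwards [CompactRouting.eventually_length_lower_bound hU hD hδ hK3] with n hn
    rw [Real.norm_of_nonneg (le_csSup (hbdd n) (Set.mem_insert 0 _)),
      Real.norm_of_nonneg (Nat.cast_nonneg n)]
    refine csSup_le ⟨0, Set.mem_insert 0 _⟩ ?_
    rintro x (rfl | ⟨d, G, F, u, s, hG, hF, hs, rfl⟩)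
    · positivity
    · have h1 : (K : ℝ) * n < 2 * K * s.length + 3 * n := by
        exact_mod_cast hn d G hG F hF u s hs
      have h2 : 3 ≤ K * (2 * c) := by
        rw [← div_le_iff₀ (by positivity)]
        linarith
      have hK0 : (0 : ℝ) < K := by
        have : (3 : ℝ) ≤ K := by exact_mod_cast hK3
        linarith
      have h3 : 3 * (n : ℝ) ≤ K * (2 * c) * n := mul_le_mul_of_nonneg_right h2 (Nat.cast_nonneg n)
      refine le_of_mul_le_mul_left ?_ (show (0 : ℝ) < 2 * K by positivity)
      linarith
  refine ⟨fun n => sSup (S n), fun n => n * sSup (S n), hf, ?_, fun n d G hG F hF => ?_⟩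
  · refine ((Asymptotics.isBigO_refl (fun n : ℕ => (n : ℝ)) Filter.atTop).mul_isLittleO
      hf).congr_right fun n => ?_
    ring
  · have hnode : ∀ (u : Fin n) (s : List Bool), CompactRouting.Stores D G u s (F u) →
        (n : ℝ) / 2 - sSup (S n) ≤ (s.length : ℝ) := by
      intro u s hs
      have := le_csSup (hbdd n) (Set.mem_insert_of_mem 0 ⟨d, G, F, u, s, hG, hF, hs, rfl⟩)
      linarith
    refine ⟨hnode, fun s hs => ?_⟩
    calc (n : ℝ) ^ 2 / 2 - n * sSup (S n) = ∑ _u : Fin n, ((n : ℝ) / 2 - sSup (S n)) := by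
          rw [Finset.sum_const, Finset.card_univ, Fintype.card_fin, nsmul_eq_mul]
          ring
      _ ≤ _ := Finset.sum_le_sum fun u _ => hnode u (s u) (hs u)
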